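/- Let $k$ be an algebraically closed field (of arbitrary characteristic), let $B$ be a finitely generated $k$-algebra that is an integral domain, i.e. the coordinate ring of an (irreducible, reduced) affine variety over $k$, and let $\mathfrak m\subset B$ be a maximal ideal. Let $R=B_{\mathfrak m}$ be the local ring of the variety at the corresponding closed point, and let $d$ be the Krull dimension of $R$. For an integer $n\ge 1$ let $$P^n_{R}=P^n_{R/k}=(R\otimes_k R)/I_R^{\,n+1},\qquad I_R=\ker\bigl(R\otimes_k R\to R,\ a\otimes b\mapsto ab\bigr),$$ be the module of principal parts of order $n$, regarded as an $R$-module through the left tensor factor. If $P^n_{R}$ is a free $R$-module of rank $\binom{n+d}{d}$, then $R$ is a regular local ring. -/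

import Mathlib

open scoped TensorProduct

/-- The module of principal parts of order `n` of a `k`-algebra `R`: the quotient
`(R ⊗[k] R) / I ^ (n + 1)`, where `I` is the kernel of the multiplication map `R ⊗[k] R → R`.
It is an `R`-algebra, hence an `R`-module, through the left tensor factor. -/
abbrev PrincipalParts (k R : Type*) [CommRing k] [CommRing R] [Algebra k R] (n : ℕ) : Type _ :=
  (R ⊗[k] R) ⧸ (RingHom.ker (Algebra.TensorProduct.lmul' k : R ⊗[k] R →ₐ[k] R)) ^ (n + 1)

/-!
Only the fibre of the module of principal parts at the closed point matters. By the Nullstellensatz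
`R` has a `k`-rational augmentation `ε : R → k` with kernel the maximal ideal `𝔪`, and
`a ⊗ b ↦ ε a • b` induces a surjection from the module of principal parts of order `n` onto
`R / 𝔪 ^ (n + 1)` that is semilinear along `ε` (`PrincipalParts.toQuotientPow`). Hence freeness of
rank `(n + d).choose d` gives `dim_k R / 𝔪 ^ (n + 1) ≤ (n + d).choose d`.

Conversely, such a bound at a single `n ≥ 1` forces regularity
(`IsLocalRing.isRegularLocalRing_of_finrank_quotient_pow_le`). Let `x₁, …, x_r` generate a reduction
of `𝔪` with as few generators as possible. Then `r ≥ d` by Krull's height theorem, and the `xᵢ` are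
algebraically independent over `k` in the associated graded ring: since `k` is infinite, a
homogeneous relation of degree `j` becomes, after a linear change of generators, monic in one of
them, and by Nakayama's lemma this one is redundant
(`IsLocalRing.exists_isReductionOf_of_aeval_mem_pow`). So the polynomials of degree at most `n` in
`r` variables, a space of dimension `(n + r).choose r`, embed into `R / 𝔪 ^ (n + 1)`. Comparing
dimensions, `r = d` and the embedding is onto; since `n ≥ 1`, every element of `𝔪` is therefore
congruent modulo `𝔪 ^ 2` to an element of `(x₁, …, x_d)`, and Nakayama's lemma shows that
`x₁, …, x_d` generate `𝔪`.
-/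

open IsLocalRing MvPolynomial

/-! ### Homogeneous forms evaluated modulo powers of an ideal -/

lemma Multiset.prod_map_mem_pow_card {R ι : Type*} [CommRing R] {M : Ideal R} {u : ι → R}
    (hu : ∀ i, u i ∈ M) (s : Multiset ι) : (s.map u).prod ∈ M ^ s.card := by
  induction s using Multiset.induction_on with
  | empty => simp
  | cons a s ih =>
    simpa [pow_succ'] using Ideal.mul_mem_mul (hu a) ih

lemma Multiset.prod_map_sub_prod_map_mem {R ι : Type*} [CommRing R] {J M : Ideal R}
    {u v : ι → R} (hu : ∀ i, u i ∈ M) (hv : ∀ i, v i ∈ M) (huv : ∀ i, u i - v i ∈ J)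
    (s : Multiset ι) :
    (s.map u).prod - (s.map v).prod ∈ J * M ^ (s.card - 1) := by
  induction s using Multiset.induction_on with
  | empty => simp
  | cons a s ih =>
    have h1 : (u a - v a) * (s.map u).prod ∈ J * M ^ s.card :=
      Ideal.mul_mem_mul (huv a) (Multiset.prod_map_mem_pow_card hu s)
    have h2 : v a * ((s.map u).prod - (s.map v).prod) ∈ J * M ^ s.card := by
      rcases Nat.eq_zero_or_pos s.card with h0 | h0
      · simp [Multiset.card_eq_zero.mp h0]
      · have := Ideal.mul_mem_mul (hv a) ih
        rwa [mul_left_comm, ← pow_succ', Nat.sub_add_cancel h0] at this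
    have := add_mem h1 h2
    simp only [Multiset.map_cons, Multiset.prod_cons, Multiset.card_cons, Nat.add_sub_cancel]
    convert this using 1
    ring

lemma Finsupp.prod_map_toMultiset {σ R : Type*} [CommMonoid R] (s : σ →₀ ℕ) (x : σ → R) :
    (s.toMultiset.map x).prod = s.prod fun i e ↦ x i ^ e := by
  rw [Finsupp.toMultiset_map, Finsupp.prod_toMultiset,
    Finsupp.prod_mapDomain_index (by simp) (by simp [pow_add])]

namespace MvPolynomial

variable {k R σ : Type*} [CommRing k] [CommRing R] [Algebra k R]

lemma aeval_monomial_eq_smul_prod_toMultiset (x : σ → R) (s : σ →₀ ℕ) (c : k) :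
    aeval x (monomial s c) = c • (s.toMultiset.map x).prod := by
  rw [aeval_monomial, Algebra.smul_def, Finsupp.prod_map_toMultiset]

lemma IsHomogeneous.card_toMultiset {F : MvPolynomial σ k} {j : ℕ} (hF : F.IsHomogeneous j)
    {s : σ →₀ ℕ} (hs : s ∈ F.support) : s.toMultiset.card = j := by
  rw [hF.degree_eq_sum_deg_support hs, Finsupp.card_toMultiset]
  rfl

lemma IsHomogeneous.aeval_mem_pow {F : MvPolynomial σ k} {j : ℕ} (hF : F.IsHomogeneous j)
    {M : Ideal R} {x : σ → R} (hx : ∀ i, x i ∈ M) : MvPolynomial.aeval x F ∈ M ^ j := by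
  rw [F.as_sum, map_sum]
  refine sum_mem fun s hs ↦ ?_
  rw [aeval_monomial_eq_smul_prod_toMultiset, ← hF.card_toMultiset hs]
  exact Submodule.smul_of_tower_mem _ _ (Multiset.prod_map_mem_pow_card hx _)

lemma IsHomogeneous.aeval_sub_aeval_mem {F : MvPolynomial σ k} {j : ℕ} (hF : F.IsHomogeneous j)
    {J M : Ideal R} {x y : σ → R} (hx : ∀ i, x i ∈ M) (hy : ∀ i, y i ∈ M)
    (hxy : ∀ i, x i - y i ∈ J) : MvPolynomial.aeval x F - MvPolynomial.aeval y F ∈ J * M ^ (j - 1) := by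
  rw [F.as_sum, map_sum, map_sum, ← Finset.sum_sub_distrib]
  refine sum_mem fun s hs ↦ ?_
  rw [aeval_monomial_eq_smul_prod_toMultiset, aeval_monomial_eq_smul_prod_toMultiset,
    ← hF.card_toMultiset hs, ← smul_sub]
  exact Submodule.smul_of_tower_mem _ _ (Multiset.prod_map_sub_prod_map_mem hx hy hxy _)

lemma IsHomogeneous.aeval_smul_const {F : MvPolynomial σ k} {j : ℕ} (hF : F.IsHomogeneous j)
    (a : σ → k) (t : R) : MvPolynomial.aeval (fun i ↦ a i • t) F = MvPolynomial.eval a F • t ^ j := by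
  conv_lhs => rw [F.as_sum]
  conv_rhs => rw [F.as_sum]
  rw [map_sum, map_sum, Finset.sum_smul]
  refine Finset.sum_congr rfl fun s hs ↦ ?_
  rw [aeval_monomial_eq_smul_prod_toMultiset, eval_monomial, mul_smul, ← hF.card_toMultiset hs]
  congr 1
  rw [← Finsupp.prod_map_toMultiset, Algebra.smul_def, map_multiset_prod, Multiset.map_map]
  simp [Algebra.smul_def, Multiset.prod_map_mul]

/-- The number of monomials of degree at most `n` in `r` variables. -/
lemma finrank_restrictTotalDegree_fin (k : Type*) [Field k] (r n : ℕ) :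
    Module.finrank k (restrictTotalDegree (Fin r) k n) = (n + r).choose r := by
  classical
  rw [← Nat.sum_range_multichoose]
  have hset : {s : Fin r →₀ ℕ | (s.sum fun _ e ↦ e) ≤ n} =
      ((Finset.range (n + 1)).biUnion fun j ↦ Finset.univ.finsuppAntidiag j :
        Finset (Fin r →₀ ℕ)) := by
    ext s
    simp [Finset.mem_finsuppAntidiag, Finsupp.sum_fintype]
  rw [restrictTotalDegree, hset, Module.finrank_eq_card_basis (basisRestrictSupport k _)]
  simp only [Finset.coe_sort_coe, Fintype.card_coe]
  rw [Finset.card_biUnion]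
  · simp [Finset.card_finsuppAntidiag_nat_eq_multichoose]
  · intro i _ j _ hij
    refine Finset.disjoint_left.mpr ?_
    intro s hs hs'
    simp only [Finset.mem_finsuppAntidiag] at hs hs'
    exact hij (hs.1.symm.trans hs'.1)

end MvPolynomial

/-! ### Minimal reductions of the maximal ideal -/

lemma Set.ncard_range_fin_le {R : Type*} {r : ℕ} (x : Fin r → R) : (Set.range x).ncard ≤ r := by
  simpa [Set.image_univ, Set.ncard_univ] using Set.ncard_image_le (f := x) Set.finite_univ

lemma Ideal.sup_span_singleton_pow_le {R : Type*} [CommRing R] {J M : Ideal R} {t : R}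
    (hJ : J ≤ M) (ht : t ∈ M) (j : ℕ) :
    (J ⊔ Ideal.span {t}) ^ (j + 1) ≤ J * M ^ j ⊔ Ideal.span {t ^ (j + 1)} := by
  induction j with
  | zero => simp
  | succ j ih =>
    have hM : J ⊔ Ideal.span {t} ≤ M := sup_le hJ ((Ideal.span_singleton_le_iff_mem _).mpr ht)
    rw [pow_succ']
    rw [Ideal.sup_mul]
    refine sup_le ((Ideal.mul_mono_right (Ideal.pow_right_mono hM _)).trans le_sup_left) ?_
    refine (Ideal.mul_mono_right ih).trans ?_
    rw [Ideal.mul_sup]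
    refine sup_le_sup ?_ ?_
    · rw [mul_left_comm, pow_succ']
      exact Ideal.mul_mono_right
        (Ideal.mul_mono_left ((Ideal.span_singleton_le_iff_mem _).mpr ht))
    · rw [Ideal.span_singleton_mul_span_singleton, ← pow_succ']

/-- The ideal `J` is a reduction of `M`: some product `J * M ^ N` contains the next power
`M ^ (N + 1)`. The usual requirement `J ≤ M`, which makes this an equality, is not part of the
definition and is supplied by the generators wherever it is needed. -/
def Ideal.IsReductionOf {R : Type*} [CommRing R] (J M : Ideal R) : Prop :=
  ∃ N, M ^ (N + 1) ≤ J * M ^ N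

lemma Ideal.pow_add_le_pow_mul {R : Type*} [CommRing R] {J M : Ideal R} {N : ℕ}
    (h : M ^ (N + 1) ≤ J * M ^ N) (j : ℕ) : M ^ (N + j) ≤ J ^ j * M ^ N := by
  induction j with
  | zero => simp
  | succ j ih =>
    calc M ^ (N + (j + 1)) = M ^ j * M ^ (N + 1) := by rw [← pow_add]; congr 1; ring
      _ ≤ M ^ j * (J * M ^ N) := Ideal.mul_mono_right h
      _ = J * M ^ (N + j) := by rw [pow_add]; ring
      _ ≤ J * (J ^ j * M ^ N) := Ideal.mul_mono_right ih
      _ = J ^ (j + 1) * M ^ N := by ring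

namespace IsLocalRing

variable {k R : Type*} [Field k] [CommRing R] [IsLocalRing R] [Algebra k R]

/-- If the generators of a reduction of the maximal ideal satisfy a homogeneous relation in the
associated graded ring that does not vanish identically on `k`-points, then a linear change of
generators makes the relation monic in one of them, and the others still generate a reduction. -/
lemma exists_isReductionOf_of_aeval_mem_pow [IsNoetherianRing R] {r j : ℕ}
    {x : Fin (r + 1) → R} (hx : ∀ i, x i ∈ maximalIdeal R)
    (hred : (Ideal.span (Set.range x)).IsReductionOf (maximalIdeal R))
    {F : MvPolynomial (Fin (r + 1)) k} (hF : F.IsHomogeneous (j + 1)) {a : Fin (r + 1) → k}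
    (ha : eval a F ≠ 0) (hFx : aeval x F ∈ maximalIdeal R ^ (j + 2)) :
    ∃ y : Fin r → R, (∀ i, y i ∈ maximalIdeal R) ∧
      (Ideal.span (Set.range y)).IsReductionOf (maximalIdeal R) := by
  set M := maximalIdeal R
  obtain ⟨i, hi⟩ : ∃ i, a i ≠ 0 := by
    by_contra! h
    obtain rfl : a = 0 := funext h
    refine ha ?_
    have := hF.coeff_eq_zero (d := 0) (by simp)
    simpa [← constantCoeff_eq] using this
  -- The vector `a` is a direction in which `F` does not vanish; `t` is the coordinate along it.
  set t : R := (a i)⁻¹ • x i with ht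
  have htM : t ∈ M := Submodule.smul_of_tower_mem _ _ (hx i)
  set y : Fin r → R := fun l ↦ x (i.succAbove l) - a (i.succAbove l) • t with hy
  have hyM (l) : y l ∈ M := sub_mem (hx _) (Submodule.smul_of_tower_mem _ _ htM)
  set J := Ideal.span (Set.range y)
  have hJM : J ≤ M := Ideal.span_le.mpr (by rintro _ ⟨l, rfl⟩; exact hyM l)
  have hxy (l) : x l - a l • t ∈ J := by
    rcases Fin.eq_self_or_eq_succAbove i l with rfl | ⟨l, rfl⟩
    · simp [ht, smul_smul, hi]
    · exact Ideal.subset_span ⟨l, rfl⟩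
  refine ⟨y, hyM, ?_⟩
  have htj : t ^ (j + 1) ∈ J * M ^ j ⊔ M ^ (j + 2) := by
    have h1 := hF.aeval_sub_aeval_mem hx (fun l ↦ Submodule.smul_of_tower_mem _ (a l) htM) hxy
    rw [hF.aeval_smul_const, Nat.add_sub_cancel] at h1
    have h2 : eval a F • t ^ (j + 1) ∈ J * M ^ j ⊔ M ^ (j + 2) := by
      rw [← sub_sub_cancel (aeval x F) (eval a F • t ^ (j + 1))]
      exact sub_mem (Ideal.mem_sup_right hFx) (Ideal.mem_sup_left h1)
    simpa [smul_smul, ha] using Submodule.smul_of_tower_mem _ (eval a F)⁻¹ h2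
  have hspan : Ideal.span (Set.range x) ≤ J ⊔ Ideal.span {t} := by
    rw [Ideal.span_le]
    rintro _ ⟨l, rfl⟩
    rw [← sub_add_cancel (x l) (a l • t)]
    exact add_mem (Ideal.mem_sup_left (hxy l)) (Ideal.mem_sup_right
      (Submodule.smul_of_tower_mem _ _ (Ideal.mem_span_singleton_self t)))
  obtain ⟨N, hN⟩ := hred
  refine ⟨N + j, Submodule.le_of_le_smul_of_le_jacobson_bot (I := M)
    (IsNoetherian.noetherian _) (IsLocalRing.maximalIdeal_le_jacobson _) ?_⟩
  calc M ^ (N + (j + 1)) ≤ Ideal.span (Set.range x) ^ (j + 1) * M ^ N :=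
        Ideal.pow_add_le_pow_mul hN _
    _ ≤ (J * M ^ j ⊔ Ideal.span {t ^ (j + 1)}) * M ^ N := Ideal.mul_mono_left
        ((Ideal.pow_right_mono hspan _).trans (Ideal.sup_span_singleton_pow_le hJM htM j))
    _ ≤ (J * M ^ j ⊔ M ^ (j + 2)) * M ^ N := Ideal.mul_mono_left
        (sup_le le_sup_left ((Ideal.span_singleton_le_iff_mem _).mpr htj))
    _ = J * M ^ (N + j) ⊔ M • M ^ (N + j + 1) := by
        rw [Ideal.sup_mul, smul_eq_mul]
        congr 1 <;> ring

/-- By Krull's height theorem, a reduction of the maximal ideal needs at least `dim R`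
generators. -/
lemma ringKrullDim_le_of_isReductionOf [IsNoetherianRing R] {r : ℕ} {x : Fin r → R}
    (hx : ∀ i, x i ∈ maximalIdeal R)
    (hred : (Ideal.span (Set.range x)).IsReductionOf (maximalIdeal R)) :
    ringKrullDim R ≤ r := by
  obtain ⟨N, hN⟩ := hred
  have hmin : maximalIdeal R ∈ (Ideal.span (Set.range x)).minimalPrimes := by
    refine ⟨⟨inferInstance, Ideal.span_le.mpr (by rintro _ ⟨l, rfl⟩; exact hx l)⟩, ?_⟩
    rintro p ⟨hp, hxp⟩ -
    exact hp.le_of_pow_le (hN.trans (Ideal.mul_le_left.trans hxp))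
  rw [← maximalIdeal_height_eq_ringKrullDim]
  have h1 := Ideal.height_le_card_of_mem_minimalPrimes_span (Set.finite_range x) hmin
  have h2 : (Set.range x).ncard ≤ r := Set.ncard_range_fin_le x
  exact_mod_cast h1.trans (by exact_mod_cast h2)

/-- A Noetherian local ring containing an infinite field `k` has at least `dim R` elements of its
maximal ideal that are algebraically independent over `k` in the associated graded ring:
the generators of a reduction of the maximal ideal with as few generators as possible. -/
theorem exists_forall_isHomogeneous_aeval_mem_pow_imp_eq_zero [Infinite k] [IsNoetherianRing R] :
    ∃ (r : ℕ) (x : Fin r → R), ringKrullDim R ≤ r ∧ (∀ i, x i ∈ maximalIdeal R) ∧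
      ∀ (j : ℕ) (F : MvPolynomial (Fin r) k), F.IsHomogeneous j →
        aeval x F ∈ maximalIdeal R ^ (j + 1) → F = 0 := by
  classical
  have hex : ∃ r, ∃ x : Fin r → R, (∀ i, x i ∈ maximalIdeal R) ∧
      (Ideal.span (Set.range x)).IsReductionOf (maximalIdeal R) := by
    obtain ⟨r, x, hx⟩ := Submodule.fg_iff_exists_fin_generating_family.mp
      (IsNoetherian.noetherian (maximalIdeal R))
    have hx' : Ideal.span (Set.range x) = maximalIdeal R := hx
    exact ⟨r, x, fun i ↦ hx' ▸ Ideal.subset_span ⟨i, rfl⟩, 0, by simp [hx']⟩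
  obtain ⟨x, hx, hred⟩ := Nat.find_spec hex
  refine ⟨Nat.find hex, x, ringKrullDim_le_of_isReductionOf hx hred, hx, fun j F hF hFx ↦ ?_⟩
  by_contra hF0
  obtain ⟨a, ha⟩ : ∃ a, eval a F ≠ 0 := by
    by_contra! h
    exact hF0 (hF.eq_zero_of_forall_eval_eq_zero h)
  generalize hr : Nat.find hex = r at *
  cases j with
  | zero =>
    rw [← totalDegree_zero_iff_isHomogeneous, totalDegree_eq_zero_iff_eq_C] at hF
    rw [hF, aeval_C, zero_add, pow_one] at hFx
    -- In degree zero, `F` is a nonzero constant of `k`, hence a unit of `R`.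
    refine hFx ((IsUnit.mk0 _ fun h ↦ hF0 ?_).map (algebraMap k R))
    rw [hF, h, C_0]
  | succ j =>
    cases r with
    | zero =>
      exact j.succ_ne_zero (hF.inj_right (isHomogeneous_of_isEmpty _ _ F) hF0)
    | succ r =>
      exact Nat.find_min hex (hr ▸ r.lt_succ_self)
        (exists_isReductionOf_of_aeval_mem_pow hx hred hF ha hFx)

end IsLocalRing

/-! ### The Hilbert function of a local ring containing an infinite field -/

namespace IsLocalRing

variable {k R : Type*} [Field k] [CommRing R] [IsLocalRing R] [Algebra k R]

/-- Elements that are algebraically independent in the associated graded ring have no polynomial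
relation of degree at most `n` modulo the `(n + 1)`-st power of the maximal ideal: the lowest
homogeneous component of such a relation would be a homogeneous relation. -/
lemma eq_zero_of_aeval_mem_pow {r : ℕ} {x : Fin r → R} (hx : ∀ i, x i ∈ maximalIdeal R)
    (hind : ∀ (j : ℕ) (F : MvPolynomial (Fin r) k), F.IsHomogeneous j →
        aeval x F ∈ maximalIdeal R ^ (j + 1) → F = 0)
    {n : ℕ} {P : MvPolynomial (Fin r) k} (hP : P.totalDegree ≤ n)
    (hPx : aeval x P ∈ maximalIdeal R ^ (n + 1)) : P = 0 := by
  have hcomp (j : ℕ) : homogeneousComponent j P = 0 := by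
    induction j using Nat.strong_induction_on with
    | _ j ih =>
      rcases lt_or_ge P.totalDegree j with hj | hj
      · exact homogeneousComponent_eq_zero _ _ hj
      refine hind j _ (homogeneousComponent_isHomogeneous j P) ?_
      have hmem : j ∈ Finset.range (P.totalDegree + 1) := by simpa [Nat.lt_succ_iff] using hj
      have hsum : aeval x (homogeneousComponent j P) = aeval x P -
          ∑ i ∈ (Finset.range (P.totalDegree + 1)).erase j, aeval x (homogeneousComponent i P) := by
        rw [eq_sub_iff_add_eq, Finset.add_sum_erase _
          (fun i ↦ aeval x (homogeneousComponent i P)) hmem, ← map_sum, sum_homogeneousComponent]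
      rw [hsum]
      refine sub_mem (Ideal.pow_le_pow_right (by omega) hPx) (sum_mem fun i hi ↦ ?_)
      rcases lt_or_gt_of_ne (Finset.ne_of_mem_erase hi) with hij | hij
      · simp [ih i hij]
      · exact Ideal.pow_le_pow_right hij
          ((homogeneousComponent_isHomogeneous i P).aeval_mem_pow hx)
  rw [← sum_homogeneousComponent P]
  exact Finset.sum_eq_zero fun i _ ↦ hcomp i

/-- A Noetherian local algebra over an infinite field `k` is regular as soon as one value of its
Hilbert–Samuel function, measured by dimension over `k`, at a positive argument, is at most that of
a power series ring over `k` of the same dimension. -/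
theorem isRegularLocalRing_of_finrank_quotient_pow_le [Infinite k] [IsNoetherianRing R]
    {d n : ℕ} (hd : ringKrullDim R = d) (hn : 1 ≤ n)
    [Module.Finite k (R ⧸ maximalIdeal R ^ (n + 1))]
    (hle : Module.finrank k (R ⧸ maximalIdeal R ^ (n + 1)) ≤ (n + d).choose d) :
    IsRegularLocalRing R := by
  obtain ⟨r, x, hr, hx, hind⟩ :=
    exists_forall_isHomogeneous_aeval_mem_pow_imp_eq_zero (k := k) (R := R)
  rw [hd] at hr
  replace hr : d ≤ r := by exact_mod_cast hr
  -- Evaluation at `x` of polynomials of degree at most `n`, modulo `𝔪 ^ (n + 1)`.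
  let φ : restrictTotalDegree (Fin r) k n →ₗ[k] R ⧸ maximalIdeal R ^ (n + 1) :=
    ((Ideal.Quotient.mkₐ k _).comp (aeval x)).toLinearMap.comp (Submodule.subtype _)
  have hφ : Function.Injective φ := by
    rw [injective_iff_map_eq_zero]
    rintro ⟨P, hP⟩ h
    exact Subtype.ext (eq_zero_of_aeval_mem_pow hx hind ((mem_restrictTotalDegree _ _ _).mp hP)
      (Ideal.Quotient.eq_zero_iff_mem.mp h))
  have hrank := finrank_restrictTotalDegree_fin k r n
  have hmono : (n + d).choose d ≤ (n + r).choose r := by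
    rw [Nat.choose_symm_add.symm, Nat.choose_symm_add.symm]
    exact Nat.choose_le_choose n (by omega)
  have hinj := LinearMap.finrank_le_finrank_of_injective hφ
  have hdr : r = d := by
    by_contra hne
    have : (n + d).choose n < (n + r).choose n :=
      calc (n + d).choose n < (n + (d + 1)).choose n := by
            obtain ⟨n, rfl⟩ := Nat.exists_eq_add_of_le' hn
            rw [← add_assoc, Nat.choose_succ_succ]
            exact Nat.lt_add_of_pos_left (Nat.choose_pos (by omega))
        _ ≤ (n + r).choose n := Nat.choose_le_choose n (by omega)
    rw [Nat.choose_symm_add, Nat.choose_symm_add] at this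
    omega
  have hsurj : Function.Surjective φ := by
    rwa [← LinearMap.injective_iff_surjective_of_finrank_eq_finrank]
    omega
  have hspan : maximalIdeal R ≤ Ideal.span (Set.range x) := by
    refine Submodule.le_of_le_smul_of_le_jacobson_bot (I := maximalIdeal R)
      (IsNoetherian.noetherian _) (IsLocalRing.maximalIdeal_le_jacobson _) fun b hb ↦ ?_
    obtain ⟨⟨P, _⟩, hPb⟩ := hsurj (Ideal.Quotient.mk _ b)
    have hP : b - aeval x P ∈ maximalIdeal R ^ (n + 1) := Ideal.Quotient.eq.mp hPb.symm
    have hx0 : aeval x P - algebraMap k R (constantCoeff P) ∈ Ideal.span (Set.range x) := by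
      rw [← Ideal.Quotient.eq, ← Ideal.Quotient.mkₐ_eq_mk k, ← AlgHom.comp_apply, comp_aeval]
      have : (fun i ↦ Ideal.Quotient.mkₐ k (Ideal.span (Set.range x)) (x i)) = 0 := by
        ext i
        exact Ideal.Quotient.eq_zero_iff_mem.mpr (Ideal.subset_span ⟨i, rfl⟩)
      rw [this, aeval_zero]
      rfl
    -- The constant term of `P` lies in `k ∩ 𝔪`, so it vanishes.
    have hc : constantCoeff P = 0 := by
      by_contra hc
      have hsub : Ideal.span (Set.range x) ≤ maximalIdeal R :=
        Ideal.span_le.mpr (by rintro _ ⟨i, rfl⟩; exact hx i)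
      have : algebraMap k R (constantCoeff P) ∈ maximalIdeal R := by
        have := sub_mem hb (add_mem (Ideal.pow_le_self n.succ_ne_zero hP) (hsub hx0))
        simpa using this
      exact this ((IsUnit.mk0 _ hc).map (algebraMap k R))
    rw [hc, map_zero, sub_zero] at hx0
    rw [← sub_add_cancel b (aeval x P), smul_eq_mul, ← pow_two]
    exact add_mem (Ideal.mem_sup_right (Ideal.pow_le_pow_right (by omega) hP))
      (Ideal.mem_sup_left hx0)
  have heq : maximalIdeal R = Ideal.span (Set.range x) :=
    hspan.antisymm (Ideal.span_le.mpr (by rintro _ ⟨i, rfl⟩; exact hx i))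
  refine IsRegularLocalRing.of_spanFinrank_maximalIdeal_le R ?_
  have h1 := Submodule.spanFinrank_span_le_ncard_of_finite (R := R) (Set.finite_range x)
  have h2 : (Set.range x).ncard ≤ r := Set.ncard_range_fin_le x
  rw [hd, heq]
  exact_mod_cast h1.trans (h2.trans hdr.le)

end IsLocalRing

/-! ### The fibre of the module of principal parts at a rational point -/

namespace PrincipalParts

variable {k R : Type*} [Field k] [CommRing R] [Algebra k R]

/-- Specialising the left tensor factor along `ε : R → k` maps the `n`-th module of principal parts
to `R / 𝔪 ^ (n + 1)`, where `𝔪` is the kernel of `ε`. -/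
noncomputable def toQuotientPow (ε : R →ₐ[k] k) (n : ℕ) :
    PrincipalParts k R n →ₐ[k] R ⧸ RingHom.ker ε ^ (n + 1) :=
  let φ : R ⊗[k] R →ₐ[k] R :=
    Algebra.TensorProduct.lift ((Algebra.ofId k R).comp ε) (AlgHom.id k R) fun _ _ ↦ .all _ _
  Ideal.quotientMapₐ _ φ <| by
    rw [← Ideal.map_le_iff_le_comap, Ideal.map_pow]
    refine Ideal.pow_right_mono (Ideal.map_le_iff_le_comap.mpr fun z hz ↦ ?_) _
    -- After applying `ε`, specialising the left factor agrees with multiplying the factors.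
    have h : ε.comp φ = ε.comp (Algebra.TensorProduct.lmul' k) := by
      ext a <;> simp [φ, Algebra.ofId_apply]
    have hz' : ε (φ z) = ε (Algebra.TensorProduct.lmul' k z) := DFunLike.congr_fun h z
    simpa [hz'] using congrArg ε (show Algebra.TensorProduct.lmul' k z = 0 from hz)

lemma toQuotientPow_mk_tmul (ε : R →ₐ[k] k) (n : ℕ) (a b : R) :
    toQuotientPow ε n (Ideal.Quotient.mk _ (a ⊗ₜ b)) =
      ε a • Ideal.Quotient.mk _ b := by
  simp [toQuotientPow, Algebra.ofId_apply, Algebra.smul_def]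

lemma toQuotientPow_surjective (ε : R →ₐ[k] k) (n : ℕ) :
    Function.Surjective (toQuotientPow ε n) := fun b ↦ by
  obtain ⟨b, rfl⟩ := Ideal.Quotient.mk_surjective b
  exact ⟨Ideal.Quotient.mk _ (1 ⊗ₜ b), by simp [toQuotientPow_mk_tmul]⟩

lemma toQuotientPow_smul (ε : R →ₐ[k] k) (n : ℕ) (a : R) (p : PrincipalParts k R n) :
    toQuotientPow ε n (a • p) = ε a • toQuotientPow ε n p := by
  obtain ⟨p, rfl⟩ := Ideal.Quotient.mk_surjective p
  have : a • (Ideal.Quotient.mk _ p : PrincipalParts k R n) =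
      Ideal.Quotient.mk _ (a ⊗ₜ 1) * Ideal.Quotient.mk _ p := by
    rw [Algebra.smul_def]; rfl
  rw [this, map_mul, toQuotientPow_mk_tmul, map_one, smul_mul_assoc, one_mul]

/-- The fibre of a finite free module of principal parts has dimension at most the rank. -/
lemma finite_and_finrank_quotient_pow_le (ε : R →ₐ[k] k) (n : ℕ)
    [Module.Free R (PrincipalParts k R n)] [Module.Finite R (PrincipalParts k R n)] :
    Module.Finite k (R ⧸ RingHom.ker ε ^ (n + 1)) ∧
      Module.finrank k (R ⧸ RingHom.ker ε ^ (n + 1)) ≤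
        Module.finrank R (PrincipalParts k R n) := by
  have : Nontrivial R := ε.toRingHom.domain_nontrivial
  let b := Module.Free.chooseBasis R (PrincipalParts k R n)
  have hspan : Submodule.span k (Set.range (toQuotientPow ε n ∘ b)) = ⊤ := by
    rw [eq_top_iff]
    rintro q -
    obtain ⟨p, rfl⟩ := toQuotientPow_surjective ε n q
    rw [← b.sum_repr p, map_sum]
    refine sum_mem fun i _ ↦ ?_
    rw [toQuotientPow_smul]
    exact Submodule.smul_mem _ _ (Submodule.subset_span ⟨i, rfl⟩)
  refine ⟨⟨hspan ▸ Submodule.fg_span (Set.finite_range _)⟩, ?_⟩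
  have h := finrank_range_le_card (R := k) (toQuotientPow ε n ∘ b)
  rwa [Set.finrank, hspan, finrank_top, ← Module.finrank_eq_card_chooseBasisIndex] at h

end PrincipalParts

/-- By the Nullstellensatz, the residue field of a closed point over an algebraically closed field
is the base field. -/
lemma exists_algHom_of_isLocalization_atPrime {k : Type*} [Field k] [IsAlgClosed k]
    {B : Type*} [CommRing B] [Algebra k B] [Algebra.FiniteType k B]
    (m : Ideal B) [m.IsMaximal]
    (R : Type*) [CommRing R] [Algebra k R] [Algebra B R] [IsScalarTower k B R]
    [IsLocalization.AtPrime R m] : Nonempty (R →ₐ[k] k) := by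
  let _ := Ideal.Quotient.field m
  have := finite_of_finite_type_of_isJacobsonRing k (B ⧸ m)
  let e := AlgEquiv.ofBijective (Algebra.ofId k (B ⧸ m))
    IsAlgClosed.algebraMap_bijective_of_isIntegral
  let f : B →ₐ[k] k := e.symm.toAlgHom.comp (Ideal.Quotient.mkₐ k m)
  refine ⟨IsLocalization.liftAlgHom (M := m.primeCompl) (f := f) fun y ↦ ?_⟩
  rw [isUnit_iff_ne_zero]
  intro h
  refine y.2 ?_
  simpa [f, Ideal.Quotient.eq_zero_iff_mem] using h

theorem mainTheorem6 {k : Type*} [Field k] [IsAlgClosed k]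
    {B : Type*} [CommRing B] [IsDomain B] [Algebra k B] [Algebra.FiniteType k B]
    (m : Ideal B) [m.IsMaximal]
    {R : Type*} [CommRing R] [Algebra k R] [Algebra B R] [IsScalarTower k B R]
    [IsLocalization.AtPrime R m]
    (d n : ℕ) (hd : ringKrullDim R = d) (hn : 1 ≤ n)
    (hfree : Module.Free R (PrincipalParts k R n))
    (hrank : Module.finrank R (PrincipalParts k R n) = (n + d).choose d) :
    IsRegularLocalRing R := by
  have := IsLocalization.AtPrime.isLocalRing R m
  have : IsNoetherianRing B := Algebra.FiniteType.isNoetherianRing k B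
  have : IsNoetherianRing R := IsLocalization.isNoetherianRing m.primeCompl R inferInstance
  have : Infinite k := IsAlgClosed.instInfinite
  obtain ⟨ε⟩ := exists_algHom_of_isLocalization_atPrime (k := k) m R
  have : Module.Finite R (PrincipalParts k R n) := Module.finite_of_finrank_pos <| by
    rw [hrank]
    exact Nat.choose_pos (Nat.le_add_left d n)
  have hker : RingHom.ker ε = maximalIdeal R := by
    have : (RingHom.ker ε).IsMaximal := RingHom.ker_isMaximal_of_surjective ε fun c ↦
      ⟨algebraMap k R c, ε.commutes c⟩
    exact eq_maximalIdeal this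
  obtain ⟨hfin, hle⟩ := PrincipalParts.finite_and_finrank_quotient_pow_le ε n
  rw [hker] at hfin hle
  exact isRegularLocalRing_of_finrank_quotient_pow_le hd hn (hle.trans_eq hrank)
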